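/- Let $M$ be a smooth finite-dimensional manifold (Hausdorff, second countable, without boundary) and let $f : M \to \mathbb{R}$ be a smooth function. For an open subset $W \subseteq M$ let $\Omega^k(W)$ ($k \ge 0$) be the space of smooth differential $k$-forms on $W$, and let $$d_f : \Omega^k(W) \to \Omega^{k+1}(W), \qquad d_f\alpha = f\,d\alpha - k\, df \wedge \alpha .$$ Then $d_f \circ d_f = 0$; let $H^k_f(W)$ denote the $k$-th cohomology space of the complex $(\Omega^\bullet(W), d_f)$. Theorem. Let $(U, V)$ be an open cover of $M$. There are linear maps $\delta : H^{k}_f(U\cap V) \to H^{k+1}_f(M)$, $k \ge 0$, such that the sequence $$0 \to H^0_f(M) \xrightarrow{R} H^0_f(U)\oplus H^0_f(V) \xrightarrow{J} H^0_f(U\cap V) \xrightarrow{\delta} H^1_f(M) \to \cdots \to H^{k-1}_f(U\cap V) \xrightarrow{\delta} H^k_f(M) \xrightarrow{R} H^k_f(U)\oplus H^k_f(V) \xrightarrow{J} H^k_f(U\cap V) \xrightarrow{\delta} H^{k+1}_f(M) \to \cdots$$ is exact, where $$R([\omega]) = ([\omega|_U], [\omega|_V]), \qquad J([\alpha],[\beta])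 = [\alpha|_{U\cap V} - \beta|_{U\cap V}] .$$ Moreover $\delta$ can be taken to be the usual connecting map: $\delta[\gamma] = [\eta]$ whenever $\gamma \in \Omega^k(U \cap V)$ and $\eta \in \Omega^{k+1}(M)$ are $d_f$-closed and there are $\alpha \in \Omega^k(U)$, $\beta \in \Omega^k(V)$ with $\gamma = \alpha|_{U\cap V} - \beta|_{U\cap V}$, $\eta|_U = d_f\alpha$ and $\eta|_V = d_f\beta$. -/

import Mathlib

open scoped Manifold ContDiff Topology
open TopologicalSpace

namespace FormCohomology

noncomputable section

set_option linter.unusedSectionVars false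

/-! ### Exterior product with a 1-form, and the exterior derivative in a normed space -/

/-- The exterior product `θ ∧ α` of a covector `θ` and an alternating `k`-form `α`:
`(θ ∧ α) (v₀, …, v_k) = ∑ i, (-1) ^ i * θ (v i) * α (v₀, …, v_(i-1), v_(i+1), …, v_k)`.
This is the normalization for which `d (g • α) = dg ∧ α + g • dα` with Mathlib's `extDeriv`. -/
def wedgeOne {T : Type*} [AddCommGroup T] [Module ℝ T] [TopologicalSpace T]
    {k : ℕ} (θ : T →L[ℝ] ℝ) (α : T [⋀^Fin k]→L[ℝ] ℝ) : T [⋀^Fin (k + 1)]→L[ℝ] ℝ :=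
  { AlternatingMap.alternatizeUncurryFin ((θ : T →ₗ[ℝ] ℝ).smulRight α.toAlternatingMap) with
    cont := by
      have h : ∀ v : Fin (k + 1) → T,
          AlternatingMap.alternatizeUncurryFin ((θ : T →ₗ[ℝ] ℝ).smulRight α.toAlternatingMap) v =
            ∑ i : Fin (k + 1), (-1 : ℝ) ^ (i : ℕ) * (θ (v i) * α (i.removeNth v)) := by
        intro v
        simp [AlternatingMap.alternatizeUncurryFin_apply]
      refine Continuous.congr ?_ fun v => (h v).symm
      refine continuous_finsetSum _ fun i _ => continuous_const.mul (Continuous.mul ?_ ?_)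
      · exact θ.continuous.comp (continuous_apply i)
      · exact α.cont.comp (continuous_pi fun j => continuous_apply _) }

theorem wedgeOne_apply {T : Type*} [AddCommGroup T] [Module ℝ T] [TopologicalSpace T]
    {k : ℕ} (θ : T →L[ℝ] ℝ) (α : T [⋀^Fin k]→L[ℝ] ℝ) (v : Fin (k + 1) → T) :
    wedgeOne θ α v = ∑ i : Fin (k + 1), (-1 : ℝ) ^ (i : ℕ) * (θ (v i) * α (i.removeNth v)) := by
  change AlternatingMap.alternatizeUncurryFin
    ((θ : T →ₗ[ℝ] ℝ).smulRight α.toAlternatingMap) v = _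
  simp [AlternatingMap.alternatizeUncurryFin_apply]

theorem wedgeOne_eq {k : ℕ} {E : Type*} [NormedAddCommGroup E] [NormedSpace ℝ E]
    (θ : E →L[ℝ] ℝ) (α : E [⋀^Fin k]→L[ℝ] ℝ) :
    wedgeOne θ α = ContinuousAlternatingMap.alternatizeUncurryFin (θ.smulRight α) := by
  ext v
  simp [wedgeOne_apply, ContinuousAlternatingMap.alternatizeUncurryFin_apply]

theorem wedgeOne_comp {T T' : Type*} [AddCommGroup T] [Module ℝ T] [TopologicalSpace T]
    [AddCommGroup T'] [Module ℝ T'] [TopologicalSpace T'] {k : ℕ} (θ : T →L[ℝ] ℝ)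
    (α : T [⋀^Fin k]→L[ℝ] ℝ) (A : T' →L[ℝ] T) :
    (wedgeOne θ α).compContinuousLinearMap A =
      wedgeOne (θ.comp A) (α.compContinuousLinearMap A) := by
  ext v
  simp only [ContinuousAlternatingMap.compContinuousLinearMap_apply, wedgeOne_apply]
  rfl

theorem contDiff_alternatize {E : Type*} [NormedAddCommGroup E] [NormedSpace ℝ E] (k : ℕ) :
    ContDiff ℝ ∞ fun g : E →L[ℝ] E [⋀^Fin k]→L[ℝ] ℝ =>
      ContinuousAlternatingMap.alternatizeUncurryFin g :=
  ContinuousLinearMap.contDiff (𝕜 := ℝ) (E := E →L[ℝ] E [⋀^Fin k]→L[ℝ] ℝ)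
    (ContinuousAlternatingMap.alternatizeUncurryFinCLM ℝ E ℝ)

open ContinuousAlternatingMap in
theorem extDeriv_mul {E : Type*} [NormedAddCommGroup E] [NormedSpace ℝ E] {k : ℕ} {F : E → ℝ}
    {w : E → E [⋀^Fin k]→L[ℝ] ℝ} {y : E} (hF : DifferentiableAt ℝ F y)
    (hw : DifferentiableAt ℝ w y) :
    extDeriv (fun z => F z • w z) y =
      F y • extDeriv w y + alternatizeUncurryFin ((fderiv ℝ F y).smulRight (w y)) := by
  rw [extDeriv, extDeriv, fderiv_fun_smul hF hw, alternatizeUncurryFin_add,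
    alternatizeUncurryFin_smul]

open ContinuousAlternatingMap in
theorem alternatize_alternatize {E : Type*} [NormedAddCommGroup E] [NormedSpace ℝ E] {k : ℕ}
    (θ : E →L[ℝ] ℝ) (α : E [⋀^Fin k]→L[ℝ] ℝ) :
    alternatizeUncurryFin (θ.smulRight (alternatizeUncurryFin (θ.smulRight α))) = 0 := by
  have h : alternatizeUncurryFin (alternatizeUncurryFinCLM ℝ E ℝ ∘L
      (θ.smulRight (θ.smulRight α))) = 0 := by
    apply alternatizeUncurryFin_alternatizeUncurryFinCLM_comp_of_symmetric
    intro x y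
    simp [smul_smul, mul_comm]
  rw [← h]
  congr 1
  ext x v
  simp

open ContinuousAlternatingMap in
theorem local_sq {E : Type*} [NormedAddCommGroup E] [NormedSpace ℝ E] {k : ℕ} {F : E → ℝ}
    {w : E → E [⋀^Fin k]→L[ℝ] ℝ} {s : Set E} (hs : IsOpen s) (hF : ContDiffOn ℝ ∞ F s)
    (hw : ContDiffOn ℝ ∞ w s) {G : E → E [⋀^Fin (k + 1)]→L[ℝ] ℝ}
    (hG : ∀ y ∈ s, G y = F y • extDeriv w y -
      (k : ℝ) • alternatizeUncurryFin ((fderiv ℝ F y).smulRight (w y))) {y : E} (hy : y ∈ s) :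
    F y • extDeriv G y -
      ((k + 1 : ℕ) : ℝ) • alternatizeUncurryFin ((fderiv ℝ F y).smulRight (G y)) = 0 := by
  have hn : s ∈ 𝓝 y := hs.mem_nhds hy
  have dF : ∀ z ∈ s, DifferentiableAt ℝ F z := fun z hz =>
    (hF.contDiffAt (hs.mem_nhds hz)).differentiableAt (by simp)
  have dw : ∀ z ∈ s, DifferentiableAt ℝ w z := fun z hz =>
    (hw.contDiffAt (hs.mem_nhds hz)).differentiableAt (by simp)
  have hdiff : ∀ {m : ℕ} {u : E → E [⋀^Fin m]→L[ℝ] ℝ}, ContDiffOn ℝ ∞ u s →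
      DifferentiableAt ℝ (extDeriv u) y := by
    intro m u hu
    have h1 : ContDiffOn ℝ ∞ (fderiv ℝ u) s := hu.fderiv_of_isOpen hs (by simp)
    have h2 : DifferentiableAt ℝ (fderiv ℝ u) y :=
      (h1.contDiffAt hn).differentiableAt (by simp)
    exact ((alternatizeUncurryFinCLM ℝ E ℝ).hasFDerivAt.comp y h2.hasFDerivAt).differentiableAt
  have hdd : ∀ {m : ℕ} {u : E → E [⋀^Fin m]→L[ℝ] ℝ}, ContDiffOn ℝ ∞ u s →
      extDeriv (extDeriv u) y = 0 := fun hu =>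
    extDeriv_extDeriv_apply (hu.contDiffAt hn)
      (by rw [minSmoothness_of_isRCLikeNormedField]; norm_cast)
  have hFw : ContDiffOn ℝ ∞ (fun z => F z • w z) s := hF.smul hw
  have hG' : G =ᶠ[𝓝 y] (((k : ℝ) + 1) • fun z => F z • extDeriv w z) +
      (-(k : ℝ)) • extDeriv (fun z => F z • w z) := by
    filter_upwards [hn] with z hz
    rw [hG z hz, Pi.add_apply, Pi.smul_apply, Pi.smul_apply, extDeriv_mul (dF z hz) (dw z hz)]
    module
  have hFd : DifferentiableAt ℝ (fun z => F z • extDeriv w z) y := (dF y hy).smul (hdiff hw)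
  have e1 : extDeriv G y = ((k : ℝ) + 1) •
      alternatizeUncurryFin ((fderiv ℝ F y).smulRight (extDeriv w y)) := by
    rw [hG'.extDeriv_eq, extDeriv_add (hFd.const_smul _) ((hdiff hFw).const_smul _),
      extDeriv_smul, extDeriv_smul, hdd hFw, extDeriv_mul (dF y hy) (hdiff hw), hdd hw]
    simp
  have e2 : (fderiv ℝ F y).smulRight (G y) = F y • (fderiv ℝ F y).smulRight (extDeriv w y) +
      (-(k : ℝ)) • (fderiv ℝ F y).smulRight
        (alternatizeUncurryFin ((fderiv ℝ F y).smulRight (w y))) := by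
    rw [hG y hy]
    ext v
    simp
    ring
  rw [e1, e2, alternatizeUncurryFin_add, alternatizeUncurryFin_smul, alternatizeUncurryFin_smul,
    alternatize_alternatize]
  push_cast
  module
/-! ### Differential forms on open subsets of a manifold -/

variable {E : Type*} [NormedAddCommGroup E] [NormedSpace ℝ E]
  {M : Type*} [TopologicalSpace M] [ChartedSpace E M]

variable (E) in
/-- Not necessarily smooth `k`-forms on the open subset `U` of `M`: sections over `U` of the bundle
of alternating `k`-forms on the tangent spaces of `M`. -/
abbrev PreForm (U : Opens M) (k : ℕ) : Type _ :=
  ∀ x : U, TangentSpace 𝓘(ℝ, E) (x : M) [⋀^Fin k]→L[ℝ] ℝ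

open Classical in
/-- Extension by zero of a form on `U` (auxiliary; only the values on `U` are ever used). -/
def PreForm.ext0 {U : Opens M} {k : ℕ} (η : PreForm E U k) (x : M) :
    TangentSpace 𝓘(ℝ, E) x [⋀^Fin k]→L[ℝ] ℝ :=
  if h : x ∈ U then η ⟨x, h⟩ else 0

/-- The differential at `p` of the preferred chart at `x₀`. -/
def chartDeriv (x₀ p : M) : TangentSpace 𝓘(ℝ, E) p →L[ℝ] E :=
  mfderiv 𝓘(ℝ, E) 𝓘(ℝ, E) (chartAt E x₀) p

/-- The differential at `y` of the inverse of the preferred chart at `x₀`. -/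
def chartSymmDeriv (x₀ : M) (y : E) :
    E →L[ℝ] TangentSpace 𝓘(ℝ, E) ((chartAt E x₀).symm y) :=
  mfderiv 𝓘(ℝ, E) 𝓘(ℝ, E) (chartAt E x₀).symm y

/-- The representation of a form on `U` in the preferred chart at `x₀`, that is, its pullback by the
inverse of that chart. Only the values on `chartDomain U x₀` are meaningful. -/
def PreForm.inChart {U : Opens M} {k : ℕ} (η : PreForm E U k) (x₀ : M) (y : E) :
    E [⋀^Fin k]→L[ℝ] ℝ :=
  (η.ext0 ((chartAt E x₀).symm y)).compContinuousLinearMap (chartSymmDeriv x₀ y)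

/-- The part of the target of the preferred chart at `x₀` which corresponds to points of `U`. -/
def chartDomain (U : Opens M) (x₀ : M) : Set E :=
  (chartAt E x₀).target ∩ (chartAt E x₀).symm ⁻¹' U

/-- A form on `U` is smooth if all its representations in charts are smooth. -/
def PreForm.IsSmooth {U : Opens M} {k : ℕ} (η : PreForm E U k) : Prop :=
  ∀ x₀ : M, ContDiffOn ℝ ∞ (η.inChart x₀) (chartDomain U x₀)

/-- The exterior derivative: at `x`, take the exterior derivative of the representation in the
preferred chart at `x` and pull it back by the chart. By `PreForm.IsSmooth.inChart_extd`
every other chart gives the same result. -/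
def PreForm.extd {U : Opens M} {k : ℕ} (η : PreForm E U k) : PreForm E U (k + 1) := fun x =>
  (extDeriv (η.inChart x) (chartAt E (x : M) x)).compContinuousLinearMap (chartDeriv (x : M) x)

/-- The differential of `f` at `x`. -/
def dAt (f : C^∞⟮𝓘(ℝ, E), M; ℝ⟯) (x : M) : TangentSpace 𝓘(ℝ, E) x →L[ℝ] ℝ :=
  mfderiv 𝓘(ℝ, E) 𝓘(ℝ, ℝ) f x

/-- The form `df ∧ η`. -/
def PreForm.dWedge {U : Opens M} {k : ℕ} (f : C^∞⟮𝓘(ℝ, E), M; ℝ⟯) (η : PreForm E U k) :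
    PreForm E U (k + 1) := fun x =>
  wedgeOne (dAt f x) (η x)

/-- The form `f η`. -/
def PreForm.fMul {U : Opens M} {k : ℕ} (f : C^∞⟮𝓘(ℝ, E), M; ℝ⟯) (η : PreForm E U k) :
    PreForm E U k := fun x => f (x : M) • η x

theorem isOpen_chartDomain (U : Opens M) (x₀ : M) : IsOpen (chartDomain (E := E) U x₀) :=
  (chartAt E x₀).isOpen_inter_preimage_symm U.isOpen

theorem PreForm.ext0_of_mem {U : Opens M} {k : ℕ} (η : PreForm E U k) {x : M} (h : x ∈ U) :
    η.ext0 x = η ⟨x, h⟩ := dif_pos h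

theorem PreForm.inChart_add {U : Opens M} {k : ℕ} (η ζ : PreForm E U k) (x₀ : M) :
    (η + ζ).inChart x₀ = η.inChart x₀ + ζ.inChart x₀ := by
  ext y v
  by_cases h : (chartAt E x₀).symm y ∈ U <;> simp [inChart, ext0, h]

theorem PreForm.inChart_sub {U : Opens M} {k : ℕ} (η ζ : PreForm E U k) (x₀ : M) :
    (η - ζ).inChart x₀ = η.inChart x₀ - ζ.inChart x₀ := by
  ext y v
  by_cases h : (chartAt E x₀).symm y ∈ U <;> simp [inChart, ext0, h]

theorem PreForm.inChart_smul {U : Opens M} {k : ℕ} (c : ℝ) (η : PreForm E U k) (x₀ : M) :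
    (c • η).inChart x₀ = c • η.inChart x₀ := by
  ext y v
  by_cases h : (chartAt E x₀).symm y ∈ U <;> simp [inChart, ext0, h]

theorem PreForm.inChart_zero {U : Opens M} {k : ℕ} (x₀ : M) :
    (0 : PreForm E U k).inChart x₀ = 0 := by
  ext y v
  by_cases h : (chartAt E x₀).symm y ∈ U <;> simp [inChart, ext0, h]

section smooth

variable [IsManifold 𝓘(ℝ, E) ∞ M]

theorem mdiff_symm (x₀ : M) {y : E} (hy : y ∈ (chartAt E x₀).target) :
    MDifferentiableAt 𝓘(ℝ, E) 𝓘(ℝ, E) (chartAt E x₀).symm y := by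
  have : IsManifold 𝓘(ℝ, E) 1 M := IsManifold.of_le (n := ∞) (by norm_cast)
  exact mdifferentiableAt_atlas_symm (chart_mem_atlas E x₀) hy

theorem mdiff_chart (x₀ : M) {p : M} (hp : p ∈ (chartAt E x₀).source) :
    MDifferentiableAt 𝓘(ℝ, E) 𝓘(ℝ, E) (chartAt E x₀) p := by
  have : IsManifold 𝓘(ℝ, E) 1 M := IsManifold.of_le (n := ∞) (by norm_cast)
  exact mdifferentiableAt_atlas (chart_mem_atlas E x₀) hp

theorem transition_contDiffAt (x₀ x₁ : M) {y : E} (hy : y ∈ (chartAt E x₀).target)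
    (hp : (chartAt E x₀).symm y ∈ (chartAt E x₁).source) :
    ContDiffAt ℝ ∞ (chartAt E x₁ ∘ (chartAt E x₀).symm) y := by
  rw [← contMDiffAt_iff_contDiffAt]
  refine ContMDiffAt.comp y (I' := 𝓘(ℝ, E)) ?_ ?_
  · exact (contMDiffOn_chart (I := 𝓘(ℝ, E)) (n := ∞)).contMDiffAt
      ((chartAt E x₁).open_source.mem_nhds hp)
  · exact (contMDiffOn_chart_symm (I := 𝓘(ℝ, E)) (n := ∞)).contMDiffAt
      ((chartAt E x₀).open_target.mem_nhds hy)

theorem chartSymmDeriv_change (x₀ x₁ : M) {y : E} (hy : y ∈ (chartAt E x₀).target)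
    (hp : (chartAt E x₀).symm y ∈ (chartAt E x₁).source) :
    (chartSymmDeriv x₀ y : E →L[ℝ] E) =
      (chartSymmDeriv x₁ ((chartAt E x₁ ∘ (chartAt E x₀).symm) y) : E →L[ℝ] E).comp
        (fderiv ℝ (chartAt E x₁ ∘ (chartAt E x₀).symm) y) := by
  have hy' : (chartAt E x₁ ∘ (chartAt E x₀).symm) y ∈ (chartAt E x₁).target :=
    (chartAt E x₁).map_source hp
  have hev : (chartAt E x₀).symm =ᶠ[𝓝 y]
      ((chartAt E x₁).symm ∘ (chartAt E x₁ ∘ (chartAt E x₀).symm)) := by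
    have : (chartAt E x₀).target ∩ (chartAt E x₀).symm ⁻¹' (chartAt E x₁).source ∈ 𝓝 y :=
      ((chartAt E x₀).isOpen_inter_preimage_symm (chartAt E x₁).open_source).mem_nhds ⟨hy, hp⟩
    filter_upwards [this] with z hz
    exact ((chartAt E x₁).left_inv hz.2).symm
  have h := mfderiv_comp (I' := 𝓘(ℝ, E)) y (mdiff_symm x₁ hy')
    ((transition_contDiffAt x₀ x₁ hy hp).contMDiffAt.mdifferentiableAt (by simp))
  rw [mfderiv_eq_fderiv] at h
  exact hev.mfderiv_eq.trans h

theorem chartDeriv_comp_chartSymmDeriv (x₀ x₁ : M) {y : E} (hy : y ∈ (chartAt E x₀).target)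
    (hp : (chartAt E x₀).symm y ∈ (chartAt E x₁).source) :
    (chartDeriv x₁ ((chartAt E x₀).symm y)).comp (chartSymmDeriv x₀ y) =
      fderiv ℝ (chartAt E x₁ ∘ (chartAt E x₀).symm) y := by
  have h := mfderiv_comp (I' := 𝓘(ℝ, E)) y (mdiff_chart x₁ hp) (mdiff_symm x₀ hy)
  rw [mfderiv_eq_fderiv] at h
  exact h.symm

theorem PreForm.ext0_comp_congr {U : Opens M} {k : ℕ} (η : PreForm E U k) {p q : M} (h : p = q)
    {A : E →L[ℝ] TangentSpace 𝓘(ℝ, E) p} {B : E →L[ℝ] TangentSpace 𝓘(ℝ, E) q}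
    (hAB : (A : E →L[ℝ] E) = (B : E →L[ℝ] E)) :
    (η.ext0 p).compContinuousLinearMap A = (η.ext0 q).compContinuousLinearMap B := by
  subst h
  subst hAB
  rfl

/-- Change of charts for the local representation of a form. -/
theorem PreForm.inChart_change {U : Opens M} {k : ℕ} (η : PreForm E U k) (x₀ x₁ : M) {y : E}
    (hy : y ∈ (chartAt E x₀).target) (hp : (chartAt E x₀).symm y ∈ (chartAt E x₁).source) :
    η.inChart x₀ y = (η.inChart x₁ ((chartAt E x₁ ∘ (chartAt E x₀).symm) y)).compContinuousLinearMap
      (fderiv ℝ (chartAt E x₁ ∘ (chartAt E x₀).symm) y) :=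
  η.ext0_comp_congr ((chartAt E x₁).left_inv hp).symm (chartSymmDeriv_change x₀ x₁ hy hp)

/-- In every chart, the exterior derivative is the exterior derivative of the representation. -/
theorem PreForm.IsSmooth.inChart_extd {U : Opens M} {k : ℕ} {η : PreForm E U k} (hη : η.IsSmooth)
    (x₀ : M) {y : E} (hy : y ∈ chartDomain U x₀) :
    η.extd.inChart x₀ y = extDeriv (η.inChart x₀) y := by
  obtain ⟨hyt, hyU⟩ := hy
  set p : M := (chartAt E x₀).symm y with hp
  have hps : p ∈ (chartAt E p).source := mem_chart_source E p
  have h1 : η.extd.inChart x₀ y = (extDeriv (η.inChart p)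
      ((chartAt E p ∘ (chartAt E x₀).symm) y)).compContinuousLinearMap
      (fderiv ℝ (chartAt E p ∘ (chartAt E x₀).symm) y) := by
    rw [← chartDeriv_comp_chartSymmDeriv x₀ p hyt hps]
    unfold inChart
    rw [PreForm.ext0_of_mem _ hyU]
    rfl
  have hmem : (chartAt E p ∘ (chartAt E x₀).symm) y ∈ chartDomain U p := by
    refine ⟨(chartAt E p).map_source hps, ?_⟩
    have : (chartAt E p).symm (chartAt E p p) = p := (chartAt E p).left_inv hps
    change (chartAt E p).symm (chartAt E p p) ∈ U
    rw [this]
    exact hyU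
  have hdiff : DifferentiableAt ℝ (η.inChart p) ((chartAt E p ∘ (chartAt E x₀).symm) y) :=
    ((hη p).contDiffAt ((isOpen_chartDomain U p).mem_nhds hmem)).differentiableAt (by simp)
  rw [h1, ← extDeriv_pullback hdiff (transition_contDiffAt x₀ p hyt hps)
    (by rw [minSmoothness_of_isRCLikeNormedField]; norm_cast)]
  refine Filter.EventuallyEq.extDeriv_eq ?_
  have : (chartAt E x₀).target ∩ (chartAt E x₀).symm ⁻¹' (chartAt E p).source ∈ 𝓝 y :=
    ((chartAt E x₀).isOpen_inter_preimage_symm (chartAt E p).open_source).mem_nhds ⟨hyt, hps⟩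
  filter_upwards [this] with z hz
  exact (η.inChart_change x₀ p hz.1 hz.2).symm

theorem PreForm.IsSmooth.extd {U : Opens M} {k : ℕ} {η : PreForm E U k} (hη : η.IsSmooth) :
    η.extd.IsSmooth := by
  intro x₀
  have h : ContDiffOn ℝ ∞ (extDeriv (η.inChart x₀)) (chartDomain U x₀) := by
    refine (contDiff_alternatize (E := E) k).comp_contDiffOn ?_
    exact (hη x₀).fderiv_of_isOpen (isOpen_chartDomain U x₀) (by simp)
  exact h.congr fun y hy => hη.inChart_extd x₀ hy

theorem inChart_fMul {U : Opens M} {k : ℕ} (f : C^∞⟮𝓘(ℝ, E), M; ℝ⟯) (η : PreForm E U k)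
    (x₀ : M) (y : E) :
    (η.fMul f).inChart x₀ y = f ((chartAt E x₀).symm y) • η.inChart x₀ y := by
  ext v
  by_cases h : (chartAt E x₀).symm y ∈ U <;> simp [PreForm.inChart, PreForm.ext0, h, PreForm.fMul]

theorem contDiffOn_inChart (f : C^∞⟮𝓘(ℝ, E), M; ℝ⟯) (x₀ : M) :
    ContDiffOn ℝ ∞ (f ∘ (chartAt E x₀).symm) (chartAt E x₀).target := by
  rw [← contMDiffOn_iff_contDiffOn]
  exact f.contMDiff.comp_contMDiffOn (contMDiffOn_chart_symm (I := 𝓘(ℝ, E)) (n := ∞))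

theorem PreForm.inChart_dWedge {U : Opens M} {k : ℕ} (f : C^∞⟮𝓘(ℝ, E), M; ℝ⟯) (η : PreForm E U k)
    (x₀ : M) {y : E} (hy : y ∈ chartDomain U x₀) :
    (η.dWedge f).inChart x₀ y =
      ContinuousAlternatingMap.alternatizeUncurryFin
        ((fderiv ℝ (f ∘ (chartAt E x₀).symm) y).smulRight (η.inChart x₀ y)) := by
  have h := mfderiv_comp (I' := 𝓘(ℝ, E)) y (f.contMDiff.mdifferentiableAt (by simp))
    (mdiff_symm x₀ hy.1)
  rw [mfderiv_eq_fderiv] at h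
  have h' : fderiv ℝ (f ∘ (chartAt E x₀).symm) y =
    (dAt f ((chartAt E x₀).symm y)).comp (chartSymmDeriv x₀ y) := h
  rw [← wedgeOne_eq, h']
  unfold inChart
  rw [PreForm.ext0_of_mem _ hy.2, PreForm.ext0_of_mem _ hy.2, ← wedgeOne_comp]
  rfl

theorem PreForm.IsSmooth.dWedge {U : Opens M} {k : ℕ} (f : C^∞⟮𝓘(ℝ, E), M; ℝ⟯) {η : PreForm E U k}
    (hη : η.IsSmooth) : (η.dWedge f).IsSmooth := by
  intro x₀
  refine ContDiffOn.congr ?_ fun y hy => η.inChart_dWedge f x₀ hy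
  refine (contDiff_alternatize (E := E) k).comp_contDiffOn ?_
  refine ContDiffOn.smulRight ?_ (hη x₀)
  exact (((contDiffOn_inChart f x₀).mono Set.inter_subset_left).fderiv_of_isOpen
    (isOpen_chartDomain U x₀) (by simp))

theorem PreForm.IsSmooth.fMul {U : Opens M} {k : ℕ} (f : C^∞⟮𝓘(ℝ, E), M; ℝ⟯) {η : PreForm E U k}
    (hη : η.IsSmooth) : (η.fMul f).IsSmooth := by
  intro x₀
  refine ContDiffOn.congr ?_ fun y _ => inChart_fMul f η x₀ y
  exact ((contDiffOn_inChart f x₀).mono Set.inter_subset_left).smul (hη x₀)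

variable (E) in
/-- The subspace of smooth `k`-forms. -/
def smoothForms (U : Opens M) (k : ℕ) : Submodule ℝ (PreForm E U k) where
  carrier := {η | η.IsSmooth}
  zero_mem' := fun x₀ => by
    rw [PreForm.inChart_zero]
    exact contDiffOn_const
  add_mem' := fun {η ζ} hη hζ x₀ => by
    rw [PreForm.inChart_add]
    exact (hη x₀).add (hζ x₀)
  smul_mem' := fun c η hη x₀ => by
    rw [PreForm.inChart_smul]
    exact contDiffOn_const.smul (hη x₀)

variable (E) in
/-- `Ω^k(U)`, the space of smooth differential `k`-forms on `U`. -/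
structure DiffForm (U : Opens M) (k : ℕ) where
  toPreForm : PreForm E U k
  isSmooth : toPreForm.IsSmooth

/-- Smooth forms as elements of the subspace of smooth forms (auxiliary, to transfer the vector
space structure, which is the pointwise one). -/
def DiffForm.equivSubmodule (U : Opens M) (k : ℕ) : DiffForm E U k ≃ smoothForms E U k where
  toFun η := ⟨η.1, η.2⟩
  invFun η := ⟨η.1, η.2⟩

instance (U : Opens M) (k : ℕ) : AddCommGroup (DiffForm E U k) :=
  (DiffForm.equivSubmodule U k).addCommGroup

instance (U : Opens M) (k : ℕ) : Module ℝ (DiffForm E U k) :=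
  (DiffForm.equivSubmodule U k).module ℝ

theorem DiffForm.ext' {U : Opens M} {k : ℕ} {η ζ : DiffForm E U k} (h : η.1 = ζ.1) : η = ζ := by
  cases η
  cases h
  rfl

theorem DiffForm.zero_toPreForm (U : Opens M) (k : ℕ) : (0 : DiffForm E U k).1 = 0 := rfl

theorem DiffForm.add_toPreForm {U : Opens M} {k : ℕ} (η ζ : DiffForm E U k) :
    (η + ζ).1 = η.1 + ζ.1 := rfl

theorem DiffForm.sub_toPreForm {U : Opens M} {k : ℕ} (η ζ : DiffForm E U k) :
    (η - ζ).1 = η.1 - ζ.1 := rfl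

theorem DiffForm.smul_toPreForm {U : Opens M} {k : ℕ} (c : ℝ) (η : DiffForm E U k) :
    (c • η).1 = c • η.1 := rfl

theorem DiffForm.ext {U : Opens M} {k : ℕ} {η ζ : DiffForm E U k}
    (h : ∀ x v, η.1 x v = ζ.1 x v) : η = ζ :=
  DiffForm.ext' (funext fun x => ContinuousAlternatingMap.ext fun v => h x v)

theorem PreForm.IsSmooth.differentiableAt {U : Opens M} {k : ℕ} {η : PreForm E U k}
    (hη : η.IsSmooth) (x : U) : DifferentiableAt ℝ (η.inChart x) (chartAt E (x : M) x) := by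
  refine ((hη x).contDiffAt ((isOpen_chartDomain U (x : M)).mem_nhds ?_)).differentiableAt (by simp)
  refine ⟨mem_chart_target E (x : M), ?_⟩
  have : (chartAt E (x : M)).symm (chartAt E (x : M) x) = x :=
    (chartAt E (x : M)).left_inv (mem_chart_source E (x : M))
  rw [Set.mem_preimage, this]
  exact x.2

/-- The exterior derivative `d : Ω^k(U) → Ω^(k+1)(U)`. -/
def extDerivForm (U : Opens M) (k : ℕ) : DiffForm E U k →ₗ[ℝ] DiffForm E U (k + 1) where
  toFun η := ⟨η.1.extd, η.2.extd⟩
  map_add' η ζ := by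
    refine DiffForm.ext fun x v => ?_
    change (extDeriv ((η.1 + ζ.1).inChart (x : M)) _).compContinuousLinearMap _ v = _
    rw [PreForm.inChart_add, extDeriv_add (PreForm.IsSmooth.differentiableAt η.2 x)
      (PreForm.IsSmooth.differentiableAt ζ.2 x)]
    rfl
  map_smul' c η := by
    refine DiffForm.ext fun x v => ?_
    change (extDeriv ((c • η.1).inChart (x : M)) _).compContinuousLinearMap _ v = _
    rw [PreForm.inChart_smul, extDeriv_smul]
    rfl

/-- The map `η ↦ df ∧ η` on smooth forms. -/
def wedgeForm (f : C^∞⟮𝓘(ℝ, E), M; ℝ⟯) (U : Opens M) (k : ℕ) :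
    DiffForm E U k →ₗ[ℝ] DiffForm E U (k + 1) where
  toFun η := ⟨η.1.dWedge f, PreForm.IsSmooth.dWedge f η.2⟩
  map_add' η ζ := by
    refine DiffForm.ext fun x v => ?_
    change wedgeOne (dAt f x) (η.1 x + ζ.1 x) v =
      wedgeOne (dAt f x) (η.1 x) v + wedgeOne (dAt f x) (ζ.1 x) v
    simp [wedgeOne_apply, mul_add, Finset.sum_add_distrib]
  map_smul' c η := by
    refine DiffForm.ext fun x v => ?_
    change wedgeOne (dAt f x) (c • η.1 x) v = c • wedgeOne (dAt f x) (η.1 x) v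
    simp only [wedgeOne_apply, ContinuousAlternatingMap.smul_apply, smul_eq_mul, Finset.mul_sum]
    exact Finset.sum_congr rfl fun i _ => by ring

/-- The map `η ↦ f η` on smooth forms. -/
def mulForm (f : C^∞⟮𝓘(ℝ, E), M; ℝ⟯) (U : Opens M) (k : ℕ) :
    DiffForm E U k →ₗ[ℝ] DiffForm E U k where
  toFun η := ⟨η.1.fMul f, PreForm.IsSmooth.fMul f η.2⟩
  map_add' η ζ := by
    refine DiffForm.ext fun x v => ?_
    exact mul_add (f (x : M)) (η.1 x v) (ζ.1 x v)
  map_smul' c η := by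
    refine DiffForm.ext fun x v => ?_
    exact mul_left_comm (f (x : M)) c (η.1 x v)

/-- The coboundary operator `d_f η = f dη - k df ∧ η` on `Ω^k(U)`. -/
def dF (f : C^∞⟮𝓘(ℝ, E), M; ℝ⟯) (U : Opens M) (k : ℕ) :
    DiffForm E U k →ₗ[ℝ] DiffForm E U (k + 1) :=
  mulForm f U (k + 1) ∘ₗ extDerivForm U k - (k : ℝ) • wedgeForm f U k

theorem dF_apply (f : C^∞⟮𝓘(ℝ, E), M; ℝ⟯) {U : Opens M} {k : ℕ} (η : DiffForm E U k) :
    (dF f U k η).1 = η.1.extd.fMul f - (k : ℝ) • η.1.dWedge f := rfl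

theorem PreForm.inChart_congr {U V : Opens M} {k : ℕ} {η : PreForm E U k} {ζ : PreForm E V k}
    {x₀ : M} {y : E} (hU : (chartAt E x₀).symm y ∈ U) (hV : (chartAt E x₀).symm y ∈ V)
    (h : η ⟨_, hU⟩ = ζ ⟨_, hV⟩) : η.inChart x₀ y = ζ.inChart x₀ y := by
  unfold inChart
  rw [ext0_of_mem _ hU, ext0_of_mem _ hV, h]

theorem mem_chartDomain {U : Opens M} (x : U) :
    chartAt E (x : M) x ∈ chartDomain U (x : M) := by
  refine ⟨mem_chart_target E (x : M), ?_⟩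
  rw [Set.mem_preimage, (chartAt E (x : M)).left_inv (mem_chart_source E (x : M))]
  exact x.2

variable (E) in
/-- The restriction `Ω^k(V) → Ω^k(U)` to a smaller open subset. -/
def restrictForm {U V : Opens M} (h : U ≤ V) (k : ℕ) : DiffForm E V k →ₗ[ℝ] DiffForm E U k where
  toFun η := ⟨fun x => η.1 ⟨x, h x.2⟩, fun x₀ =>
    ((η.2 x₀).mono fun y hy => (⟨hy.1, h hy.2⟩ : y ∈ chartDomain V x₀)).congr fun _ hy =>
      PreForm.inChart_congr hy.2 (h hy.2) rfl⟩
  map_add' _ _ := rfl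
  map_smul' _ _ := rfl

theorem dF_restrictForm (f : C^∞⟮𝓘(ℝ, E), M; ℝ⟯) {U V : Opens M} (h : U ≤ V) (k : ℕ)
    (η : DiffForm E V k) :
    dF f U k (restrictForm E h k η) = restrictForm E h (k + 1) (dF f V k η) := by
  refine DiffForm.ext' ?_
  have hd : (restrictForm E h k η).1.extd = fun x : U => η.1.extd ⟨x, h x.2⟩ := by
    funext x
    have : (restrictForm E h k η).1.inChart (x : M) =ᶠ[𝓝 (chartAt E (x : M) x)]
        η.1.inChart (x : M) := by
      filter_upwards [(isOpen_chartDomain U (x : M)).mem_nhds (mem_chartDomain x)] with y hy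
      exact PreForm.inChart_congr hy.2 (h hy.2) rfl
    unfold PreForm.extd
    rw [this.extDeriv_eq]
  rw [dF_apply, hd]
  rfl

theorem PreForm.inChart_dF (f : C^∞⟮𝓘(ℝ, E), M; ℝ⟯) {U : Opens M} {k : ℕ} (η : DiffForm E U k)
    (x₀ : M) {y : E} (hy : y ∈ chartDomain U x₀) :
    (dF f U k η).1.inChart x₀ y =
      (f ∘ (chartAt E x₀).symm) y • extDeriv (η.1.inChart x₀) y -
        (k : ℝ) • ContinuousAlternatingMap.alternatizeUncurryFin
          ((fderiv ℝ (f ∘ (chartAt E x₀).symm) y).smulRight (η.1.inChart x₀ y)) := by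
  rw [dF_apply, PreForm.inChart_sub, PreForm.inChart_smul,
    Pi.sub_apply, Pi.smul_apply, inChart_fMul, IsSmooth.inChart_extd η.2 x₀ hy,
    inChart_dWedge f _ x₀ hy]
  rfl

theorem PreForm.eq_zero_of_inChart {U : Opens M} {k : ℕ} {η : PreForm E U k}
    (h : ∀ x₀ : M, ∀ y ∈ chartDomain U x₀, η.inChart x₀ y = 0) : η = 0 := by
  funext x
  have hs := mem_chart_source E (x : M)
  have e : (chartAt E (x : M)).symm (chartAt E (x : M) x) = x := (chartAt E (x : M)).left_inv hs
  have h1 := mfderiv_comp (I' := 𝓘(ℝ, E)) (x : M)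
    (mdiff_symm (x : M) (mem_chart_target E (x : M))) (mdiff_chart (x : M) hs)
  have hev : (chartAt E (x : M)).symm ∘ chartAt E (x : M) =ᶠ[𝓝 (x : M)] id := by
    filter_upwards [(chartAt E (x : M)).open_source.mem_nhds hs] with z hz
    exact (chartAt E (x : M)).left_inv hz
  have h2 : (chartSymmDeriv (x : M) (chartAt E (x : M) x) : E →L[ℝ] E).comp
      (chartDeriv (x : M) x : E →L[ℝ] E) = ContinuousLinearMap.id ℝ E :=
    h1.symm.trans (hev.mfderiv_eq.trans mfderiv_id)
  have key : ∀ p : M, p = x → ∀ A : E →L[ℝ] E,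
      A.comp (chartDeriv (x : M) x : E →L[ℝ] E) = ContinuousLinearMap.id ℝ E →
      ContinuousAlternatingMap.compContinuousLinearMap (η.ext0 p : E [⋀^Fin k]→L[ℝ] ℝ) A = 0 →
      (η x : E [⋀^Fin k]→L[ℝ] ℝ) = 0 := by
    rintro p rfl A hA h0
    rw [PreForm.ext0_of_mem _ x.2] at h0
    ext v
    have h3 := congrArg
      (fun B : E [⋀^Fin k]→L[ℝ] ℝ => B (fun i => (chartDeriv (x : M) x : E →L[ℝ] E) (v i))) h0
    have h4 : (fun i => A ((chartDeriv (x : M) x : E →L[ℝ] E) (v i))) = v := by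
      funext i
      exact congrArg (fun B : E →L[ℝ] E => B (v i)) hA
    change (η x : E [⋀^Fin k]→L[ℝ] ℝ)
      (fun i => A ((chartDeriv (x : M) x : E →L[ℝ] E) (v i))) = 0 at h3
    rw [h4] at h3
    exact h3
  exact key _ e _ h2 (h (x : M) _ (mem_chartDomain x))

/-- `d_f ∘ d_f = 0`. -/
theorem dF_dF (f : C^∞⟮𝓘(ℝ, E), M; ℝ⟯) (U : Opens M) (k : ℕ) (η : DiffForm E U k) :
    dF f U (k + 1) (dF f U k η) = 0 := by
  refine DiffForm.ext' (PreForm.eq_zero_of_inChart fun x₀ y hy => ?_)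
  rw [PreForm.inChart_dF f _ x₀ hy]
  exact local_sq (isOpen_chartDomain U x₀) ((contDiffOn_inChart f x₀).mono Set.inter_subset_left)
    (η.2 x₀) (fun z hz => PreForm.inChart_dF f η x₀ hz) hy

/-! ### The cohomology `H^k_f` and the maps of the Mayer-Vietoris sequence -/

/-- The `k`-cocycles of the complex `(Ω^•(U), d_f)`. -/
def cocycles (f : C^∞⟮𝓘(ℝ, E), M; ℝ⟯) (U : Opens M) (k : ℕ) : Submodule ℝ (DiffForm E U k) :=
  LinearMap.ker (dF f U k)

/-- The `k`-coboundaries of the complex `(Ω^•(U), d_f)`. -/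
def coboundaries (f : C^∞⟮𝓘(ℝ, E), M; ℝ⟯) (U : Opens M) :
    (k : ℕ) → Submodule ℝ (DiffForm E U k)
  | 0 => ⊥
  | k + 1 => LinearMap.range (dF f U k)

/-- `H^k_f(U)`, the `k`-th cohomology space of the complex `(Ω^•(U), d_f)`; for `U = ⊤` this is
`H^k_f(M)`. -/
abbrev Cohomology (f : C^∞⟮𝓘(ℝ, E), M; ℝ⟯) (U : Opens M) (k : ℕ) : Type _ :=
  cocycles f U k ⧸ (coboundaries f U k).submoduleOf (cocycles f U k)

/-- The cohomology class of a cocycle. -/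
def cohomologyClass (f : C^∞⟮𝓘(ℝ, E), M; ℝ⟯) (U : Opens M) (k : ℕ) :
    cocycles f U k →ₗ[ℝ] Cohomology f U k :=
  ((coboundaries f U k).submoduleOf (cocycles f U k)).mkQ

/-- The restriction of cocycles to a smaller open subset. -/
def restrictCocycle (f : C^∞⟮𝓘(ℝ, E), M; ℝ⟯) {U V : Opens M} (h : U ≤ V) (k : ℕ) :
    cocycles f V k →ₗ[ℝ] cocycles f U k :=
  (restrictForm E h k).restrict fun η hη => by
    have h0 : dF f V k η = 0 := hη
    change dF f U k (restrictForm E h k η) = 0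
    rw [dF_restrictForm, h0, map_zero]

/-- The restriction map `H^k_f(V) → H^k_f(U)`, `[η] ↦ [η|_U]`. -/
def restrictCohomology (f : C^∞⟮𝓘(ℝ, E), M; ℝ⟯) {U V : Opens M} (h : U ≤ V) (k : ℕ) :
    Cohomology f V k →ₗ[ℝ] Cohomology f U k :=
  Submodule.mapQ _ _ (restrictCocycle f h k) <| by
    rintro ⟨η, hη⟩ hb
    cases k with
    | zero =>
      have hb' : η = 0 := hb
      subst hb'
      exact map_zero (restrictForm E h 0)
    | succ k =>
      obtain ⟨ζ, hζ⟩ : ∃ ζ, dF f V k ζ = η := hb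
      exact ⟨restrictForm E h k ζ, by rw [dF_restrictForm, hζ]; rfl⟩

/-- `R : H^k_f(M) → H^k_f(U) ⊕ H^k_f(V)`, `R [η] = ([η|_U], [η|_V])`. -/
def mvR (f : C^∞⟮𝓘(ℝ, E), M; ℝ⟯) (U V : Opens M) (k : ℕ) :
    Cohomology f ⊤ k →ₗ[ℝ] Cohomology f U k × Cohomology f V k :=
  (restrictCohomology f le_top k).prod (restrictCohomology f le_top k)

/-- `J : H^k_f(U) ⊕ H^k_f(V) → H^k_f(U ∩ V)`, `J ([α], [β]) = [α|_(U ∩ V) - β|_(U ∩ V)]`. -/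
def mvJ (f : C^∞⟮𝓘(ℝ, E), M; ℝ⟯) (U V : Opens M) (k : ℕ) :
    Cohomology f U k × Cohomology f V k →ₗ[ℝ] Cohomology f (U ⊓ V) k :=
  restrictCohomology f inf_le_left k ∘ₗ LinearMap.fst ℝ _ _ -
    restrictCohomology f inf_le_right k ∘ₗ LinearMap.snd ℝ _ _

theorem mvR_class (f : C^∞⟮𝓘(ℝ, E), M; ℝ⟯) (U V : Opens M) (k : ℕ) (η : cocycles f ⊤ k) :
    mvR f U V k (cohomologyClass f ⊤ k η) =
      (cohomologyClass f U k (restrictCocycle f le_top k η),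
        cohomologyClass f V k (restrictCocycle f le_top k η)) := rfl

theorem mvJ_class (f : C^∞⟮𝓘(ℝ, E), M; ℝ⟯) (U V : Opens M) (k : ℕ) (α : cocycles f U k)
    (β : cocycles f V k) :
    mvJ f U V k (cohomologyClass f U k α, cohomologyClass f V k β) =
      cohomologyClass f (U ⊓ V) k
        (restrictCocycle f inf_le_left k α - restrictCocycle f inf_le_right k β) := rfl

end smooth

end

end FormCohomology

/-! The sequence is the long exact cohomology sequence of the short exact sequence of complexes 0 →
Ω(M) → Ω(U) ⊕ Ω(V) → Ω(U ∩ V) → 0 with maps `formR` and `formJ`. About `d_f` only two facts are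
needed: it squares to zero (`dF_dF`) and it commutes with restriction (`dF_restrictForm`), so that
both maps are cochain maps.

Exactness on the left and in the middle is the sheaf property of smooth forms: a form on M is
determined by its restrictions, and forms that agree on the overlap glue (`DiffForm.exists_glue`).
Surjectivity on the right (`DiffForm.exists_sub_eq`) is the analytic input. A smooth function g that
is 0 near the complement of V and 1 near the complement of U splits γ as gγ - (g - 1)γ, where gγ
extends by zero to U and (g - 1)γ to V. Hausdorffness, second countability and finite dimension
serve only to produce g.

The rest is diagram chasing with zigzags: p with J p = c and η with R η = d_f p. The key lemma is
`mem_coboundaries_of_zigzag`: if c is a coboundary, so is η. It makes the connecting map well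
defined and independent of all choices. Exactness at the terms next to δ is then deduced from the
zigzag characterization of δ alone. -/

namespace FormCohomology

noncomputable section

variable {E : Type*} [NormedAddCommGroup E] [NormedSpace ℝ E]
  {M : Type*} [TopologicalSpace M] [ChartedSpace E M] [IsManifold 𝓘(ℝ, E) ∞ M]

/-! ### Gluing forms -/

/-- Smoothness of a form is a local property. -/
theorem PreForm.isSmooth_of_local {W : Opens M} {k : ℕ} {η : PreForm E W k}
    (h : ∀ x ∈ W, ∃ U : Opens M, x ∈ U ∧ ∃ ζ : PreForm E U k, ζ.IsSmooth ∧
      ∀ z (hW : z ∈ W) (hU : z ∈ U), η ⟨z, hW⟩ = ζ ⟨z, hU⟩) : η.IsSmooth := by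
  intro x₀ y hy
  obtain ⟨U, hxU, ζ, hζ, heq⟩ := h _ hy.2
  have hyU : chartDomain (E := E) U x₀ ∈ 𝓝 y := (isOpen_chartDomain U x₀).mem_nhds ⟨hy.1, hxU⟩
  refine (((hζ x₀).contDiffAt hyU).congr_of_eventuallyEq ?_).contDiffWithinAt
  -- Both chart domains are open and contain the point, so the two representations agree near it,
  -- not only at it.
  filter_upwards [hyU, (isOpen_chartDomain W x₀).mem_nhds hy] with z hzU hzW
  exact PreForm.inChart_congr hzW.2 hzU.2 (heq _ hzW.2 hzU.2)

theorem DiffForm.eq_of_restrictForm {U V : Opens M} (hUV : U ⊔ V = ⊤) {k : ℕ}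
    {η ζ : DiffForm E (⊤ : Opens M) k}
    (hU : restrictForm E (le_top : U ≤ ⊤) k η = restrictForm E le_top k ζ)
    (hV : restrictForm E (le_top : V ≤ ⊤) k η = restrictForm E le_top k ζ) : η = ζ := by
  refine DiffForm.ext' (funext fun x => ?_)
  have hx : (x : M) ∈ U ⊔ V := by rw [hUV]; trivial
  rcases hx with hx | hx
  · exact congrFun (congrArg DiffForm.toPreForm hU) ⟨x, hx⟩
  · exact congrFun (congrArg DiffForm.toPreForm hV) ⟨x, hx⟩

open Classical in
/-- Forms on `U` and `V` which agree on `U ∩ V` glue to a form on `M = U ∪ V`. -/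
theorem DiffForm.exists_glue {U V : Opens M} (hUV : U ⊔ V = ⊤) {k : ℕ}
    {α : DiffForm E U k} {β : DiffForm E V k}
    (h : restrictForm E (inf_le_left : U ⊓ V ≤ U) k α = restrictForm E inf_le_right k β) :
    ∃ η : DiffForm E (⊤ : Opens M) k,
      restrictForm E le_top k η = α ∧ restrictForm E le_top k η = β := by
  -- The default value 0 of `ext0` is never reached: a point outside U lies in V.
  let η : PreForm E (⊤ : Opens M) k := fun x => if (x : M) ∈ U then α.1.ext0 x else β.1.ext0 x
  have hηU : ∀ x (hx : x ∈ U), η ⟨x, trivial⟩ = α.1 ⟨x, hx⟩ := fun x hx =>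
    (if_pos hx).trans (PreForm.ext0_of_mem _ hx)
  have hηV : ∀ x (hx : x ∈ V), η ⟨x, trivial⟩ = β.1 ⟨x, hx⟩ := fun x hx => by
    by_cases hxU : x ∈ U
    · exact (hηU x hxU).trans (congrFun (congrArg DiffForm.toPreForm h) ⟨x, hxU, hx⟩)
    · exact (if_neg hxU).trans (PreForm.ext0_of_mem _ hx)
  refine ⟨⟨η, PreForm.isSmooth_of_local fun x _ => ?_⟩, DiffForm.ext' (funext fun x => hηU x x.2),
    DiffForm.ext' (funext fun x => hηV x x.2)⟩
  have hx : x ∈ U ⊔ V := by rw [hUV]; trivial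
  rcases hx with hx | hx
  · exact ⟨U, hx, α.1, α.2, fun z _ hz => hηU z hz⟩
  · exact ⟨V, hx, β.1, β.2, fun z _ hz => hηV z hz⟩

/-- If `g` vanishes near the points of `U` outside `W`, then `g γ` extends by zero from `W`
to `U`. -/
theorem DiffForm.exists_extension {W U : Opens M} (hWU : W ≤ U) {k : ℕ}
    (g : C^∞⟮𝓘(ℝ, E), M; ℝ⟯) (hg : ∀ x ∈ U, x ∉ W → ∀ᶠ z in 𝓝 x, g z = 0)
    (γ : DiffForm E W k) :
    ∃ α : DiffForm E U k, restrictForm E hWU k α = mulForm g W k γ := by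
  let α : PreForm E U k := fun x => (γ.1.fMul g).ext0 x
  have hα : ∀ x (hxU : x ∈ U) (hx : x ∈ W), α ⟨x, hxU⟩ = γ.1.fMul g ⟨x, hx⟩ := fun x _ hx =>
    PreForm.ext0_of_mem _ hx
  refine ⟨⟨α, PreForm.isSmooth_of_local fun x hxU => ?_⟩,
    DiffForm.ext' (funext fun x => hα x (hWU x.2) x.2)⟩
  by_cases hx : x ∈ W
  · exact ⟨W, hx, _, PreForm.IsSmooth.fMul g γ.2, hα⟩
  -- Near a point of U outside W the extension is identically zero: on W because g vanishes there,
  -- off W by the default value of `ext0`.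
  · obtain ⟨N, hN, hNo, hxN⟩ := eventually_nhds_iff.1 (hg x hxU hx)
    refine ⟨⟨N, hNo⟩, hxN, 0, (0 : DiffForm E (⟨N, hNo⟩ : Opens M) k).2, fun z hzU hzN => ?_⟩
    by_cases hz : z ∈ W
    · rw [hα z hzU hz]
      change g z • γ.1 ⟨z, hz⟩ = 0
      rw [hN z hzN, zero_smul]
    · exact dif_neg hz

/-- Every form on `U ∩ V` is a difference of forms on `U` and on `V`. -/
theorem DiffForm.exists_sub_eq [FiniteDimensional ℝ E] [T2Space M] [SecondCountableTopology M]
    {U V : Opens M} (hUV : U ⊔ V = ⊤) {k : ℕ} (γ : DiffForm E (U ⊓ V) k) :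
    ∃ (α : DiffForm E U k) (β : DiffForm E V k),
      restrictForm E inf_le_left k α - restrictForm E inf_le_right k β = γ := by
  have : LocallyCompactSpace M := ChartedSpace.locallyCompactSpace E M
  have hd : Disjoint (V : Set M)ᶜ (U : Set M)ᶜ := by
    rw [Set.disjoint_left]
    intro x hxV hxU
    have hx : x ∈ U ⊔ V := by rw [hUV]; trivial
    exact hx.elim hxU hxV
  -- The values 0 and 1 are taken on neighbourhoods of the closed sets. Values on the sets alone
  -- would not suffice, since γ may be unbounded near the boundary of U ∩ V.
  obtain ⟨g, hg0, hg1, -⟩ := exists_contMDiffMap_zero_one_nhds_of_isClosed 𝓘(ℝ, E)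
    V.isOpen.isClosed_compl U.isOpen.isClosed_compl hd
  rw [eventually_nhdsSet_iff_forall] at hg0 hg1
  obtain ⟨α, hα⟩ := DiffForm.exists_extension (inf_le_left : U ⊓ V ≤ U) g
    (fun x hxU hx => hg0 x fun hxV => hx ⟨hxU, hxV⟩) γ
  -- The factor is g - 1 rather than 1 - g because β enters the difference with a minus sign.
  obtain ⟨β, hβ⟩ := DiffForm.exists_extension (inf_le_right : U ⊓ V ≤ V) (g - 1)
    (fun x hxV hx => (hg1 x fun hxU => hx ⟨hxU, hxV⟩).mono fun z hz => sub_eq_zero.2 hz) γ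
  refine ⟨α, β, ?_⟩
  rw [hα, hβ]
  refine DiffForm.ext fun x v => ?_
  change g x * γ.1 x v - (g x - 1) * γ.1 x v = γ.1 x v
  ring

/-! ### The short exact sequence of complexes -/

/-- The map `Ω^k(M) → Ω^k(U) ⊕ Ω^k(V)`, `η ↦ (η|_U, η|_V)`. -/
def formR (U V : Opens M) (k : ℕ) :
    DiffForm E (⊤ : Opens M) k →ₗ[ℝ] DiffForm E U k × DiffForm E V k :=
  (restrictForm E le_top k).prod (restrictForm E le_top k)

/-- The map `Ω^k(U) ⊕ Ω^k(V) → Ω^k(U ∩ V)`, `(α, β) ↦ α|_(U ∩ V) - β|_(U ∩ V)`. -/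
def formJ (U V : Opens M) (k : ℕ) :
    DiffForm E U k × DiffForm E V k →ₗ[ℝ] DiffForm E (U ⊓ V) k :=
  restrictForm E inf_le_left k ∘ₗ LinearMap.fst ℝ _ _ -
    restrictForm E inf_le_right k ∘ₗ LinearMap.snd ℝ _ _

/-- The coboundary operator on `Ω^k(U) ⊕ Ω^k(V)`. -/
def dFProd (f : C^∞⟮𝓘(ℝ, E), M; ℝ⟯) (U V : Opens M) (k : ℕ) :
    DiffForm E U k × DiffForm E V k →ₗ[ℝ] DiffForm E U (k + 1) × DiffForm E V (k + 1) :=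
  (dF f U k).prodMap (dF f V k)

theorem formR_injective {U V : Opens M} (hUV : U ⊔ V = ⊤) (k : ℕ) :
    Function.Injective (formR (E := E) U V k) := fun _ _ h =>
  DiffForm.eq_of_restrictForm hUV (congrArg Prod.fst h) (congrArg Prod.snd h)

theorem formJ_formR {U V : Opens M} {k : ℕ} (η : DiffForm E (⊤ : Opens M) k) :
    formJ U V k (formR U V k η) = 0 :=
  sub_self (restrictForm E (le_top : U ⊓ V ≤ ⊤) k η)

theorem exists_formR_eq {U V : Opens M} (hUV : U ⊔ V = ⊤) {k : ℕ}
    {p : DiffForm E U k × DiffForm E V k} (h : formJ U V k p = 0) :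
    ∃ η, formR U V k η = p := by
  obtain ⟨η, h1, h2⟩ := DiffForm.exists_glue hUV (sub_eq_zero.1 h)
  exact ⟨η, Prod.ext h1 h2⟩

theorem formJ_surjective [FiniteDimensional ℝ E] [T2Space M] [SecondCountableTopology M]
    {U V : Opens M} (hUV : U ⊔ V = ⊤) (k : ℕ) :
    Function.Surjective (formJ (E := E) U V k) := fun γ =>
  let ⟨α, β, h⟩ := DiffForm.exists_sub_eq hUV γ
  ⟨(α, β), h⟩

variable (f : C^∞⟮𝓘(ℝ, E), M; ℝ⟯)

theorem formR_dF {U V : Opens M} {k : ℕ} (η : DiffForm E (⊤ : Opens M) k) :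
    formR U V (k + 1) (dF f ⊤ k η) = dFProd f U V k (formR U V k η) :=
  Prod.ext (dF_restrictForm f le_top k η).symm (dF_restrictForm f le_top k η).symm

theorem formJ_dFProd {U V : Opens M} {k : ℕ} (p : DiffForm E U k × DiffForm E V k) :
    formJ U V (k + 1) (dFProd f U V k p) = dF f (U ⊓ V) k (formJ U V k p) := by
  change restrictForm E inf_le_left (k + 1) (dF f U k p.1) -
    restrictForm E inf_le_right (k + 1) (dF f V k p.2) =
    dF f (U ⊓ V) k (restrictForm E inf_le_left k p.1 - restrictForm E inf_le_right k p.2)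
  rw [map_sub, dF_restrictForm, dF_restrictForm]

theorem dFProd_dFProd {U V : Opens M} {k : ℕ} (p : DiffForm E U k × DiffForm E V k) :
    dFProd f U V (k + 1) (dFProd f U V k p) = 0 :=
  Prod.ext (dF_dF f U k p.1) (dF_dF f V k p.2)

/-! ### Cohomology classes -/

theorem cohomologyClass_surjective (U : Opens M) (k : ℕ) :
    Function.Surjective (cohomologyClass f U k) := Submodule.mkQ_surjective _

theorem cohomologyClass_eq_zero {U : Opens M} {k : ℕ} {η : cocycles f U k} :
    cohomologyClass f U k η = 0 ↔ η.1 ∈ coboundaries f U k :=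
  Submodule.Quotient.mk_eq_zero _

theorem dF_of_mem_coboundaries {U : Opens M} {k : ℕ} {η : DiffForm E U k}
    (h : η ∈ coboundaries f U k) : dF f U k η = 0 := by
  cases k with
  | zero =>
    have h' : η = 0 := h
    rw [h', map_zero]
  | succ k =>
    obtain ⟨ζ, rfl⟩ := h
    exact dF_dF f U k ζ

/-! ### Zigzags and the connecting map -/

/-- A coboundary on `U ∩ V` is a difference of coboundaries on `U` and on `V`. -/
theorem exists_formJ_eq_of_mem_coboundaries [FiniteDimensional ℝ E] [T2Space M]
    [SecondCountableTopology M] {U V : Opens M} (hUV : U ⊔ V = ⊤) {k : ℕ}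
    {c : DiffForm E (U ⊓ V) k} (h : c ∈ coboundaries f (U ⊓ V) k) :
    ∃ p : DiffForm E U k × DiffForm E V k, formJ U V k p = c ∧
      p.1 ∈ coboundaries f U k ∧ p.2 ∈ coboundaries f V k := by
  cases k with
  | zero =>
    have h' : c = 0 := h
    exact ⟨0, by rw [h', map_zero], Submodule.zero_mem _, Submodule.zero_mem _⟩
  | succ k =>
    -- It is the primitive b that is split over U and V; applying `d_f` to the pieces splits c into
    -- coboundaries.
    obtain ⟨b, rfl⟩ := h
    obtain ⟨a, rfl⟩ := formJ_surjective hUV k b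
    exact ⟨dFProd f U V k a, formJ_dFProd f a, ⟨a.1, rfl⟩, ⟨a.2, rfl⟩⟩

/-- In a zigzag `c = α|_(U ∩ V) - β|_(U ∩ V)`, `η|_U = d_f α`, `η|_V = d_f β`, if `c` is a
coboundary, then so is `η`. -/
theorem mem_coboundaries_of_zigzag [FiniteDimensional ℝ E] [T2Space M]
    [SecondCountableTopology M] {U V : Opens M} (hUV : U ⊔ V = ⊤) {k : ℕ}
    {p : DiffForm E U k × DiffForm E V k} {η : DiffForm E (⊤ : Opens M) (k + 1)}
    (hp : formJ U V k p ∈ coboundaries f (U ⊓ V) k)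
    (hη : formR U V (k + 1) η = dFProd f U V k p) : η ∈ coboundaries f ⊤ (k + 1) := by
  -- Replacing p by p - q leaves `d_f p` unchanged and makes the pair agree on U ∩ V. The glued form
  -- ζ is then a primitive of η.
  obtain ⟨q, hq, hq1, hq2⟩ := exists_formJ_eq_of_mem_coboundaries f hUV hp
  obtain ⟨ζ, hζ⟩ := exists_formR_eq hUV (p := p - q) (by rw [map_sub, hq, sub_self])
  have hdq : dFProd f U V k q = 0 :=
    Prod.ext (dF_of_mem_coboundaries f hq1) (dF_of_mem_coboundaries f hq2)
  refine ⟨ζ, formR_injective hUV _ ?_⟩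
  rw [formR_dF, hζ, map_sub, hdq, sub_zero, hη]

/-- A form on `M` whose restrictions to `U` and `V` are cocycles is a cocycle. -/
theorem mem_cocycles_of_formR {U V : Opens M} (hUV : U ⊔ V = ⊤) {k : ℕ}
    {η : DiffForm E (⊤ : Opens M) k} (h : dFProd f U V k (formR U V k η) = 0) :
    η ∈ cocycles f ⊤ k :=
  formR_injective hUV _ (by rw [formR_dF, h, map_zero])

/-- The connecting map, with its characterization by zigzags. -/
theorem exists_connectingMap [FiniteDimensional ℝ E] [T2Space M]
    [SecondCountableTopology M] {U V : Opens M} (hUV : U ⊔ V = ⊤) (k : ℕ) :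
    ∃ δ : Cohomology f (U ⊓ V) k →ₗ[ℝ] Cohomology f ⊤ (k + 1),
      ∀ (c : cocycles f (U ⊓ V) k) (p : DiffForm E U k × DiffForm E V k)
        (η : cocycles f ⊤ (k + 1)), formJ U V k p = c.1 →
        formR U V (k + 1) η.1 = dFProd f U V k p →
        δ (cohomologyClass f (U ⊓ V) k c) = cohomologyClass f ⊤ (k + 1) η := by
  -- Over a field, J has a linear section S and R a linear retraction L. They need not commute with
  -- `d_f`; they only make δ, induced by L ∘ d_f ∘ S, linear by construction.
  obtain ⟨S, hS⟩ := (formJ (E := E) U V k).exists_rightInverse_of_surjective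
    (LinearMap.range_eq_top.2 (formJ_surjective hUV k))
  obtain ⟨L, hL⟩ := (formR (E := E) U V (k + 1)).exists_leftInverse_of_injective
    (LinearMap.ker_eq_bot.2 (formR_injective hUV (k + 1)))
  have hS' : ∀ c, formJ U V k (S c) = c := fun c => LinearMap.congr_fun hS c
  have hL' : ∀ η, L (formR U V (k + 1) η) = η := fun η => LinearMap.congr_fun hL η
  let P : DiffForm E (U ⊓ V) k →ₗ[ℝ] DiffForm E (⊤ : Opens M) (k + 1) :=
    L ∘ₗ dFProd f U V k ∘ₗ S
  -- L inverts R only on the range of R. For a cocycle c, `d_f (S c)` lies in that range because J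
  -- sends it to `d_f c = 0`.
  have hP : ∀ c ∈ cocycles f (U ⊓ V) k,
      formR U V (k + 1) (P c) = dFProd f U V k (S c) := by
    intro c hc
    have hc' : dF f (U ⊓ V) k c = 0 := hc
    obtain ⟨η, hη⟩ := exists_formR_eq hUV (p := dFProd f U V k (S c))
      (by rw [formJ_dFProd, hS', hc'])
    change formR U V (k + 1) (L (dFProd f U V k (S c))) = _
    rw [← hη, hL']
  let D : cocycles f (U ⊓ V) k →ₗ[ℝ] cocycles f ⊤ (k + 1) := P.restrict fun c hc =>
    mem_cocycles_of_formR f hUV (by rw [hP c hc, dFProd_dFProd])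
  refine ⟨Submodule.liftQ _ (cohomologyClass f ⊤ (k + 1) ∘ₗ D) fun c hc => ?_,
    fun c p η hp hη => ?_⟩
  · refine (cohomologyClass_eq_zero f).2 ?_
    have hc' : c.1 ∈ coboundaries f (U ⊓ V) k := hc
    exact mem_coboundaries_of_zigzag f hUV (p := S c.1) (by rwa [hS']) (hP c.1 c.2)
  · change cohomologyClass f ⊤ (k + 1) (D c) = _
    rw [← sub_eq_zero, ← map_sub, cohomologyClass_eq_zero]
    -- The difference of two zigzags over the same c is a zigzag over 0, so its end is a coboundary.
    refine mem_coboundaries_of_zigzag f hUV (p := S c.1 - p) ?_ ?_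
    · rw [map_sub, hS', hp, sub_self]
      exact Submodule.zero_mem _
    · change formR U V (k + 1) (P c.1 - η.1) = _
      rw [map_sub, map_sub, hP c.1 c.2, hη]

/-! ### Exactness of the long sequence -/

theorem mvR_zero_injective {U V : Opens M} (hUV : U ⊔ V = ⊤) :
    Function.Injective (mvR f U V 0) := by
  refine (injective_iff_map_eq_zero _).2 fun a ha => ?_
  obtain ⟨η, rfl⟩ := cohomologyClass_surjective f _ _ a
  rw [mvR_class] at ha
  -- In degree 0 the coboundaries are `⊥`, so a vanishing class means a vanishing form.
  have h1 := (cohomologyClass_eq_zero f).1 (congrArg Prod.fst ha)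
  have h2 := (cohomologyClass_eq_zero f).1 (congrArg Prod.snd ha)
  have h : η.1 = 0 := formR_injective hUV 0 (Prod.ext h1 h2)
  exact (cohomologyClass_eq_zero f).2 h

/-- If α - β is a coboundary on the overlap, then α and β can be changed by coboundaries on U and V
so that they agree there. The corrected pair glues to a cocycle on M. -/
theorem exact_mvR_mvJ [FiniteDimensional ℝ E] [T2Space M]
    [SecondCountableTopology M] {U V : Opens M} (hUV : U ⊔ V = ⊤) (k : ℕ) :
    Function.Exact (mvR f U V k) (mvJ f U V k) := by
  rintro ⟨a, b⟩
  constructor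
  · intro h
    obtain ⟨α, rfl⟩ := cohomologyClass_surjective f _ _ a
    obtain ⟨β, rfl⟩ := cohomologyClass_surjective f _ _ b
    rw [mvJ_class, cohomologyClass_eq_zero] at h
    obtain ⟨q, hq, hq1, hq2⟩ := exists_formJ_eq_of_mem_coboundaries f hUV h
    obtain ⟨σ, hσ⟩ := exists_formR_eq hUV (p := (α.1, β.1) - q)
      (by rw [map_sub, hq]; exact sub_self _)
    have hc : σ ∈ cocycles f ⊤ k := by
      refine mem_cocycles_of_formR f hUV ?_
      have hα : dF f U k α.1 = 0 := α.2
      have hβ : dF f V k β.1 = 0 := β.2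
      rw [hσ, map_sub]
      refine Prod.ext ?_ ?_
      · change dF f U k α.1 - dF f U k q.1 = 0
        rw [hα, dF_of_mem_coboundaries f hq1, sub_zero]
      · change dF f V k β.1 - dF f V k q.2 = 0
        rw [hβ, dF_of_mem_coboundaries f hq2, sub_zero]
    refine ⟨cohomologyClass f ⊤ k ⟨σ, hc⟩, ?_⟩
    rw [mvR_class, ← sub_eq_zero, Prod.mk_sub_mk, ← map_sub, ← map_sub]
    refine Prod.ext ((cohomologyClass_eq_zero f).2 ?_) ((cohomologyClass_eq_zero f).2 ?_)
    · have h1 : restrictForm E le_top k σ = α.1 - q.1 := congrArg Prod.fst hσ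
      change restrictForm E le_top k σ - α.1 ∈ _
      rw [h1, sub_sub_cancel_left]
      exact Submodule.neg_mem _ hq1
    · have h2 : restrictForm E le_top k σ = β.1 - q.2 := congrArg Prod.snd hσ
      change restrictForm E le_top k σ - β.1 ∈ _
      rw [h2, sub_sub_cancel_left]
      exact Submodule.neg_mem _ hq2
  · rintro ⟨c, hc⟩
    obtain ⟨η, rfl⟩ := cohomologyClass_surjective f _ _ c
    rw [← hc, mvR_class, mvJ_class, cohomologyClass_eq_zero]
    have h : formJ U V k (formR U V k η.1) ∈ coboundaries f (U ⊓ V) k := by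
      rw [formJ_formR]
      exact Submodule.zero_mem _
    exact h

/-- If the zigzag of c ends in a coboundary `d_f ζ`, subtracting R ζ from p makes p closed without
changing J p = c. Conversely, a closed pair (α, β) starts a zigzag that ends in 0. -/
theorem exact_mvJ_connectingMap [FiniteDimensional ℝ E] [T2Space M]
    [SecondCountableTopology M] {U V : Opens M} (hUV : U ⊔ V = ⊤) {k : ℕ}
    {δ : Cohomology f (U ⊓ V) k →ₗ[ℝ] Cohomology f ⊤ (k + 1)}
    (hδ : ∀ (c : cocycles f (U ⊓ V) k) (p : DiffForm E U k × DiffForm E V k)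
        (η : cocycles f ⊤ (k + 1)), formJ U V k p = c.1 →
        formR U V (k + 1) η.1 = dFProd f U V k p →
        δ (cohomologyClass f (U ⊓ V) k c) = cohomologyClass f ⊤ (k + 1) η) :
    Function.Exact (mvJ f U V k) δ := by
  intro a
  constructor
  · intro h
    obtain ⟨c, rfl⟩ := cohomologyClass_surjective f _ _ a
    obtain ⟨p, hp⟩ := formJ_surjective hUV k c.1
    have hc : dF f (U ⊓ V) k c.1 = 0 := c.2
    obtain ⟨η, hη⟩ := exists_formR_eq hUV (p := dFProd f U V k p)
      (by rw [formJ_dFProd, hp, hc])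
    have hη' : η ∈ cocycles f ⊤ (k + 1) :=
      mem_cocycles_of_formR f hUV (by rw [hη, dFProd_dFProd])
    rw [hδ c p ⟨η, hη'⟩ hp hη, cohomologyClass_eq_zero] at h
    obtain ⟨ζ, hζ⟩ : ∃ ζ, dF f ⊤ k ζ = η := h
    have hz : dFProd f U V k (p - formR U V k ζ) = 0 := by
      rw [map_sub, ← formR_dF, hζ, hη, sub_self]
    refine ⟨(cohomologyClass f U k ⟨_, congrArg Prod.fst hz⟩,
      cohomologyClass f V k ⟨_, congrArg Prod.snd hz⟩), ?_⟩
    rw [mvJ_class]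
    refine congrArg _ (Subtype.ext ?_)
    change formJ U V k (p - formR U V k ζ) = c.1
    rw [map_sub, formJ_formR, sub_zero, hp]
  · rintro ⟨⟨u, v⟩, rfl⟩
    obtain ⟨α, rfl⟩ := cohomologyClass_surjective f _ _ u
    obtain ⟨β, rfl⟩ := cohomologyClass_surjective f _ _ v
    rw [mvJ_class, hδ _ (α.1, β.1) 0 rfl, map_zero]
    have hα : dF f U k α.1 = 0 := α.2
    have hβ : dF f V k β.1 = 0 := β.2
    exact (map_zero _).trans (Prod.ext hα.symm hβ.symm)

/-- Primitives α, β of the two restrictions of η form a zigzag read backwards: α - β is a cocycle on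
the overlap, and δ sends its class to that of η. -/
theorem exact_connectingMap_mvR [FiniteDimensional ℝ E] [T2Space M]
    [SecondCountableTopology M] {U V : Opens M} (hUV : U ⊔ V = ⊤) {k : ℕ}
    {δ : Cohomology f (U ⊓ V) k →ₗ[ℝ] Cohomology f ⊤ (k + 1)}
    (hδ : ∀ (c : cocycles f (U ⊓ V) k) (p : DiffForm E U k × DiffForm E V k)
        (η : cocycles f ⊤ (k + 1)), formJ U V k p = c.1 →
        formR U V (k + 1) η.1 = dFProd f U V k p →
        δ (cohomologyClass f (U ⊓ V) k c) = cohomologyClass f ⊤ (k + 1) η) :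
    Function.Exact δ (mvR f U V (k + 1)) := by
  intro a
  constructor
  · intro h
    obtain ⟨η, rfl⟩ := cohomologyClass_surjective f _ _ a
    rw [mvR_class] at h
    obtain ⟨α, hα⟩ : ∃ α, dF f U k α = restrictForm E le_top (k + 1) η.1 :=
      (cohomologyClass_eq_zero f).1 (congrArg Prod.fst h)
    obtain ⟨β, hβ⟩ : ∃ β, dF f V k β = restrictForm E le_top (k + 1) η.1 :=
      (cohomologyClass_eq_zero f).1 (congrArg Prod.snd h)
    have hη : formR U V (k + 1) η.1 = dFProd f U V k (α, β) := Prod.ext hα.symm hβ.symm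
    have hc : formJ U V k (α, β) ∈ cocycles f (U ⊓ V) k := by
      change dF f (U ⊓ V) k _ = 0
      rw [← formJ_dFProd, ← hη, formJ_formR]
    exact ⟨cohomologyClass f (U ⊓ V) k ⟨_, hc⟩, hδ ⟨_, hc⟩ (α, β) η rfl hη⟩
  · rintro ⟨b, rfl⟩
    obtain ⟨c, rfl⟩ := cohomologyClass_surjective f _ _ b
    -- Since δ is known only through `hδ`, a zigzag over c is built first; its components p are
    -- primitives of the restrictions of η.
    obtain ⟨p, hp⟩ := formJ_surjective hUV k c.1
    have hc : dF f (U ⊓ V) k c.1 = 0 := c.2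
    obtain ⟨η, hη⟩ := exists_formR_eq hUV (p := dFProd f U V k p)
      (by rw [formJ_dFProd, hp, hc])
    have hη' : η ∈ cocycles f ⊤ (k + 1) :=
      mem_cocycles_of_formR f hUV (by rw [hη, dFProd_dFProd])
    rw [hδ c p ⟨η, hη'⟩ hp hη, mvR_class]
    exact Prod.ext
      ((cohomologyClass_eq_zero f).2 ⟨p.1, (congrArg Prod.fst hη).symm⟩)
      ((cohomologyClass_eq_zero f).2 ⟨p.2, (congrArg Prod.snd hη).symm⟩)

end

end FormCohomology

/-- **Mayer-Vietoris sequence for `H_f`.** The connecting maps `δ` are moreover the usual ones: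
`δ [c] = [η]` whenever `c = α|_(U ∩ V) - β|_(U ∩ V)`, `η|_U = d_f α` and `η|_V = d_f β`. -/
theorem mainTheorem5 {E : Type*} [NormedAddCommGroup E] [NormedSpace ℝ E] [FiniteDimensional ℝ E]
    {M : Type*} [TopologicalSpace M] [T2Space M] [SecondCountableTopology M]
    [ChartedSpace E M] [IsManifold 𝓘(ℝ, E) ∞ M]
    (f : C^∞⟮𝓘(ℝ, E), M; ℝ⟯) (U V : TopologicalSpace.Opens M) (hUV : U ⊔ V = ⊤) :
    ∃ δ : ∀ k : ℕ, FormCohomology.Cohomology f (U ⊓ V) k →ₗ[ℝ]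
        FormCohomology.Cohomology f ⊤ (k + 1),
      Function.Injective (FormCohomology.mvR f U V 0) ∧
      (∀ k : ℕ, Function.Exact (FormCohomology.mvR f U V k) (FormCohomology.mvJ f U V k)) ∧
      (∀ k : ℕ, Function.Exact (FormCohomology.mvJ f U V k) (δ k)) ∧
      (∀ k : ℕ, Function.Exact (δ k) (FormCohomology.mvR f U V (k + 1))) ∧
      (∀ (k : ℕ) (c : FormCohomology.cocycles f (U ⊓ V) k)
        (α : FormCohomology.DiffForm E U k) (β : FormCohomology.DiffForm E V k)
        (η : FormCohomology.cocycles f ⊤ (k + 1)),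
        FormCohomology.restrictForm E inf_le_left k α -
          FormCohomology.restrictForm E inf_le_right k β = c.1 →
        FormCohomology.restrictForm E le_top (k + 1) η.1 = FormCohomology.dF f U k α →
        FormCohomology.restrictForm E le_top (k + 1) η.1 = FormCohomology.dF f V k β →
        δ k (FormCohomology.cohomologyClass f (U ⊓ V) k c) =
          FormCohomology.cohomologyClass f ⊤ (k + 1) η) := by
  choose δ hδ using FormCohomology.exists_connectingMap f hUV
  exact ⟨δ, FormCohomology.mvR_zero_injective f hUV, FormCohomology.exact_mvR_mvJ f hUV,
    fun k => FormCohomology.exact_mvJ_connectingMap f hUV (hδ k),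
    fun k => FormCohomology.exact_connectingMap_mvR f hUV (hδ k),
    fun k c α β η hc hα hβ => hδ k c (α, β) η hc (Prod.ext hα hβ)⟩
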